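/- Let $d \ge 1$ and let $\mathbb{R}^d$ carry the $\ell_p$ norm $\|\cdot\|$ for some $p \in [1,\infty]$ ($p = 2$ being the Euclidean case). For $V \subseteq \mathbb{R}^d$ and $r \ge 0$ let $G_r(V)$ be the graph with vertex set $V$ in which two distinct points $u, v$ are adjacent if and only if $\|u - v\| \le r$, and for an integer $k \ge 1$ let $N_{k,r}(V)$ be the maximum number of points of $V$ that can be properly coloured in $G_r(V)$ with $k$ colours. For $\lambda > 0$ let $\mathcal{X}_\lambda$ be a Poisson point process of intensity $\lambda$ in $\mathbb{R}^d$, and put $F_{k,\lambda}(t) = N_{k,1}([0,t]^d \cap \mathcal{X}_\lambda)$ for $t \ge 0$. Then, for all $k \ge 1$ and $\lambda > 0$, the variables $F_{k,\lambda}(t)/(\lambda t^d)$, $t > 0$, are integrable, and $$\frac{F_{k,\lambda}(t)}{\lambda t^d} \longrightarrow a_{k,\lambda} := \inf_{s > 0} \mathbb{E}\left[\frac{F_{k,\lambda}(s)}{\lambda s^d}\right] \quad \text{in probability as } t \to \infty,$$ where the constant $a_{k,\lambda}$ depends only on $k$, $\lambda$, $d$ and $p$ (and not on the probability space on which the process is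 realised). -/

import Mathlib

open MeasureTheory ProbabilityTheory Filter

noncomputable section

/-- The random geometric graph `G_r(V)`: the vertices are the points of `V ⊆ ℝ^d`, and two distinct
points are adjacent iff their `ℓ_p`-distance is at most `r` (`p = 2` is the Euclidean case). -/
def geometricGraph (p : ENNReal) [Fact (1 ≤ p)] {d : ℕ} (r : ℝ) (V : Set (Fin d → ℝ)) :
    SimpleGraph V where
  Adj u v := u ≠ v ∧ ‖WithLp.toLp p (u.1 - v.1)‖ ≤ r
  symm := ⟨fun u v h => ⟨h.1.symm, by
    have e : WithLp.toLp p (v.1 - u.1) = -WithLp.toLp p (u.1 - v.1) := by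
      rw [← WithLp.toLp_neg, neg_sub]
    rw [e, norm_neg]
    exact h.2⟩⟩
  loopless := ⟨fun _ h => h.1 rfl⟩

/-- The maximum number of vertices of `G` that can be properly coloured with `k` colours. -/
def maxColorable {W : Type*} (G : SimpleGraph W) (k : ℕ) : ℕ∞ :=
  ⨆ (S : Set W) (_ : (G.induce S).Colorable k), S.encard

/-- `N_{k,r}(V)`, the maximum number of points of `V` that can be properly coloured with `k` colours
in `G_r(V)`. -/
def maxColoredPoints (p : ENNReal) [Fact (1 ≤ p)] {d : ℕ} (k : ℕ) (r : ℝ)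
    (V : Set (Fin d → ℝ)) : ℕ∞ :=
  maxColorable (geometricGraph p r V) k

/-- The random set `X` of points of `ℝ^d` is a Poisson point process of intensity `lam` under `P`:
the number of its points in each Borel set is a random variable, this number is Poisson distributed
with mean `lam * |B|` for each Borel set `B` of finite volume `|B|`, and the numbers of its points
in finitely many pairwise disjoint Borel sets are independent. -/
structure IsPoissonPointProcess {Ω : Type*} [MeasurableSpace Ω] {d : ℕ} (lam : ℝ)
    (X : Ω → Set (Fin d → ℝ)) (P : Measure Ω) : Prop where
  measurable_count : ∀ B : Set (Fin d → ℝ), MeasurableSet B →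
    Measurable fun ω => (X ω ∩ B).encard
  map_count : ∀ B : Set (Fin d → ℝ), MeasurableSet B → volume B ≠ ⊤ →
    P.map (fun ω => (X ω ∩ B).encard) =
      (poissonMeasure (lam * volume.real B).toNNReal).map (fun n : ℕ => (n : ℕ∞))
  iIndepFun_count : ∀ (n : ℕ) (B : Fin n → Set (Fin d → ℝ)), (∀ i, MeasurableSet (B i)) →
    (∀ i j, i ≠ j → Disjoint (B i) (B j)) →
    iIndepFun (fun (i : Fin n) (ω : Ω) => (X ω ∩ B i).encard) P

/-- `F_{k,lam}(t) = N_{k,1}([0,t]^d ∩ X)` as a real number. A set of points in a cube without two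
points within distance `1` is finite, of bounded size, so that the value in `ℕ∞` is never `⊤`. -/
def coloredCount (p : ENNReal) [Fact (1 ≤ p)] {d : ℕ} (k : ℕ) {Ω : Type*}
    (X : Ω → Set (Fin d → ℝ)) (t : ℝ) (ω : Ω) : ℝ :=
  ((maxColoredPoints p k 1 (Set.Icc (fun _ => (0 : ℝ)) (fun _ => t) ∩ X ω)).toNat : ℝ)

/-- The colouring ratio `F_{k,lam}(t) / (lam * t ^ d)`. -/
def coloringRatio (p : ENNReal) [Fact (1 ≤ p)] {d : ℕ} (k : ℕ) (lam : ℝ) {Ω : Type*}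
    (X : Ω → Set (Fin d → ℝ)) (t : ℝ) (ω : Ω) : ℝ :=
  coloredCount p k X t ω / (lam * t ^ d)

end

/-! The number `N(B)` of colourable points in a window `B` is subadditive in `B`, and for a Poisson
process the numbers in disjoint windows are uncorrelated and their means translation invariant.
Covering `[0, t]^d` by `M ^ d` disjoint cubes of a fixed side `s`, with `M / t → 1 / s`, bounds the ratio of
`[0, t]^d` from above by a normalized sum `S` of uncorrelated bounded variables. The mean of `S` is
close to the mean ratio for `s`, hence to the infimum `a` for a good choice of `s`, and its variance
is of order `t⁻ᵈ`. So the positive part of `ratio - a` is small in mean; as the mean of the ratio is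
never below `a`, the negative part has no larger mean, and the ratio converges to `a` in `L¹`
(`integral_abs_sub_le`, `IsPoissonPointProcess.tendsto_integral_abs_coloringRatio_sub`).

The process enters through a discretization. Points with the same colour must have distance
`> 1`, an open condition, so an optimal coloured set is recognized from the set of occupied dyadic
cells as soon as the grid is fine enough (`eventually_colorNumber_cell_eq`). The discretized count
is a function of finitely many cell counts, which are independent Poisson variables. By dominated
convergence this gives measurability of `N(B)`, vanishing covariance for disjoint windows, and a
formula for the mean which does not mention the realization (`windowMean`); this formula defines the
constant `a`. -/

noncomputable section

/-! ### Colouring numbers of subsets of a relation -/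

/-- The set `T` can be coloured with the colours `0, …, k - 1` so that distinct `R`-related points
of `T` get different colours. The colouring is a function on the whole type; its values off `T` are
irrelevant. -/
def IsColorableOn {W : Type*} (R : W → W → Prop) (k : ℕ) (T : Set W) : Prop :=
  ∃ c : W → ℕ, (∀ x ∈ T, c x < k) ∧ ∀ x ∈ T, ∀ y ∈ T, x ≠ y → R x y → c x ≠ c y

/-- The supremum of the sizes of the finite subsets of `O` that can be coloured with `k` colours. -/
def colorNumber {W : Type*} (R : W → W → Prop) (k : ℕ) (O : Set W) : ℕ∞ :=
  ⨆ (T : Finset W) (_ : (T : Set W) ⊆ O ∧ IsColorableOn R k T), (T.card : ℕ∞)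

section
variable {W : Type*} {R : W → W → Prop} {k : ℕ} {O O' : Set W}

lemma IsColorableOn.mono {S T : Set W} (h : IsColorableOn R k T) (hST : S ⊆ T) :
    IsColorableOn R k S := by
  obtain ⟨c, h1, h2⟩ := h
  exact ⟨c, fun x hx => h1 x (hST hx), fun x hx y hy => h2 x (hST hx) y (hST hy)⟩

lemma colorNumber_le_iff {m : ℕ∞} : colorNumber R k O ≤ m ↔
    ∀ T : Finset W, (T : Set W) ⊆ O → IsColorableOn R k T → (T.card : ℕ∞) ≤ m := by
  simp only [colorNumber, iSup_le_iff, and_imp]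

lemma card_le_colorNumber {T : Finset W} (h : (T : Set W) ⊆ O) (hc : IsColorableOn R k T) :
    (T.card : ℕ∞) ≤ colorNumber R k O :=
  colorNumber_le_iff.1 le_rfl T h hc

lemma colorNumber_mono (h : O ⊆ O') : colorNumber R k O ≤ colorNumber R k O' :=
  colorNumber_le_iff.2 fun _ hT hc => card_le_colorNumber (hT.trans h) hc

/-- A finite supremum is attained. -/
lemma exists_card_eq_colorNumber (h : colorNumber R k O ≠ ⊤) :
    ∃ T : Finset W, (T : Set W) ⊆ O ∧ IsColorableOn R k T ∧ (T.card : ℕ∞) = colorNumber R k O := by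
  obtain ⟨m, hm⟩ := ENat.ne_top_iff_exists.1 h
  by_contra! hcon
  have hlt : ∀ T : Finset W, (T : Set W) ⊆ O → IsColorableOn R k T → T.card < m := by
    intro T h1 h2
    have h3 := lt_of_le_of_ne (card_le_colorNumber h1 h2) (hcon T h1 h2)
    rw [← hm] at h3
    exact_mod_cast h3
  have h0 : 0 < m := by
    simpa using hlt ∅ (by simp) ⟨fun _ => 0, by simp, by simp⟩
  have : colorNumber R k O ≤ ((m - 1 : ℕ) : ℕ∞) := colorNumber_le_iff.2 fun T h1 h2 => by
    have := hlt T h1 h2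
    exact_mod_cast (by omega : T.card ≤ m - 1)
  rw [← hm] at this
  have h5 : m ≤ m - 1 := by exact_mod_cast this
  omega

lemma colorNumber_le_sum {ι : Type*} (s : Finset ι) (V : ι → Set W) (h : O ⊆ ⋃ i ∈ s, V i) :
    colorNumber R k O ≤ ∑ i ∈ s, colorNumber R k (V i) := by
  classical
  refine colorNumber_le_iff.2 fun T hT hc => ?_
  have hcov : T ⊆ s.biUnion fun i => T.filter (· ∈ V i) := by
    intro x hx
    have := h (hT hx)
    simp only [Set.mem_iUnion, exists_prop] at this
    obtain ⟨i, hi, hxi⟩ := this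
    exact Finset.mem_biUnion.2 ⟨i, hi, Finset.mem_filter.2 ⟨hx, hxi⟩⟩
  calc (T.card : ℕ∞) ≤ ((∑ i ∈ s, (T.filter (· ∈ V i)).card : ℕ) : ℕ∞) := by
        exact_mod_cast (Finset.card_le_card hcov).trans Finset.card_biUnion_le
    _ = ∑ i ∈ s, ((T.filter (· ∈ V i)).card : ℕ∞) := by push_cast; rfl
    _ ≤ _ := Finset.sum_le_sum fun i _ => card_le_colorNumber
        (fun x hx => (Finset.mem_filter.1 hx).2)
        (hc.mono fun x hx => (Finset.mem_filter.1 hx).1)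

/-- Every finite subset of the image lifts to a set of representatives, and a colouring of it pulls
back along `f`. -/
lemma colorNumber_image_le {W' : Type*} {R' : W' → W' → Prop} (f : W → W')
    (hf : ∀ x y, R x y → R' (f x) (f y)) : colorNumber R' k (f '' O) ≤ colorNumber R k O := by
  classical
  refine colorNumber_le_iff.2 fun T hT ⟨c, hc1, hc2⟩ => ?_
  obtain ⟨S, hS, hinj, rfl⟩ := Finset.exists_subset_injOn_image_eq_of_surjOn (f := f) O T hT
  rw [Finset.card_image_of_injOn hinj]
  refine card_le_colorNumber hS ⟨c ∘ f, fun x hx => hc1 _ ?_, fun x hx y hy hxy hR => ?_⟩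
  · exact Finset.mem_coe.2 (Finset.mem_image_of_mem f hx)
  · exact hc2 _ (Finset.mem_coe.2 (Finset.mem_image_of_mem f hx)) _
      (Finset.mem_coe.2 (Finset.mem_image_of_mem f hy)) (fun e => hxy (hinj hx hy e)) (hf _ _ hR)

end

section
variable {d : ℕ}

/-- Two points of `ℝ^d` at `ℓ_p`-distance at most `1`. -/
def IsClose (p : ENNReal) [Fact (1 ≤ p)] (x y : Fin d → ℝ) : Prop :=
  ‖WithLp.toLp p (x - y)‖ ≤ 1

variable {p : ENNReal} [Fact (1 ≤ p)] {k : ℕ}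

lemma maxColoredPoints_eq_colorNumber (V : Set (Fin d → ℝ)) :
    maxColoredPoints p k 1 V = colorNumber (IsClose p) k V := by
  classical
  apply le_antisymm
  · refine iSup₂_le fun S hS => ?_
    obtain ⟨C⟩ := hS
    refine ENat.forall_natCast_le_iff_le.1 fun m hm => ?_
    obtain ⟨t, htS, ht⟩ := Set.exists_subset_encard_eq hm
    have hfin : t.Finite := Set.finite_of_encard_eq_coe ht
    have hcard : ((hfin.toFinset.image Subtype.val).card : ℕ∞) = m := by
      rw [Finset.card_image_of_injective _ Subtype.val_injective,
        ← hfin.encard_eq_coe_toFinset_card, ht]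
    rw [← hcard]
    refine card_le_colorNumber ?_ ⟨fun x => if h : ∃ hx : x ∈ V, (⟨x, hx⟩ : V) ∈ S then
      (C ⟨⟨x, h.1⟩, h.2⟩ : Fin k) else 0, ?_, ?_⟩
    · intro x hx
      obtain ⟨y, -, rfl⟩ := Finset.mem_image.1 (Finset.mem_coe.1 hx)
      exact y.2
    · intro x hx
      obtain ⟨y, hy, rfl⟩ := Finset.mem_image.1 (Finset.mem_coe.1 hx)
      have h : ∃ hx : y.1 ∈ V, (⟨y.1, hx⟩ : V) ∈ S := ⟨y.2, htS (by simpa using hy)⟩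
      simp only [dif_pos h]
      exact Fin.is_lt _
    · intro x hx y hy hxy hR
      obtain ⟨x, hx', rfl⟩ := Finset.mem_image.1 (Finset.mem_coe.1 hx)
      obtain ⟨y, hy', rfl⟩ := Finset.mem_image.1 (Finset.mem_coe.1 hy)
      have h1 : ∃ hx : x.1 ∈ V, (⟨x.1, hx⟩ : V) ∈ S := ⟨x.2, htS (by simpa using hx')⟩
      have h2 : ∃ hx : y.1 ∈ V, (⟨y.1, hx⟩ : V) ∈ S := ⟨y.2, htS (by simpa using hy')⟩
      simp only [dif_pos h1, dif_pos h2]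
      intro e
      exact C.valid (v := ⟨x, h1.2⟩) (w := ⟨y, h2.2⟩) ⟨fun e => hxy (congrArg _ e), hR⟩ (Fin.ext e)
  · refine colorNumber_le_iff.2 fun T hT ⟨c, hc1, hc2⟩ => ?_
    refine le_trans (le_of_eq ?_) (le_iSup₂ (f := fun (S : Set V)
      (_ : ((geometricGraph p 1 V).induce S).Colorable k) => S.encard)
      (Subtype.val ⁻¹' (T : Set (Fin d → ℝ))) ⟨SimpleGraph.Coloring.mk
        (fun v => ⟨c v.1.1, hc1 _ v.2⟩) ?_⟩)
    · rw [Set.encard_preimage_of_injective_subset_range Subtype.val_injective (by simpa using hT),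
        Set.encard_coe_eq_coe_finsetCard]
    · intro v w hvw e
      exact hc2 _ v.2 _ w.2 (fun e => hvw.1 (Subtype.ext e)) hvw.2 (Fin.ext_iff.1 e)

/-! ### Dyadic cells -/

/-- The label of the half-open dyadic cube of side `2⁻ⁿ` that contains `x`. -/
def cellIndex (n : ℕ) (x : Fin d → ℝ) : Fin d → ℤ := fun i => ⌊2 ^ n * x i⌋

/-- Two dyadic cells of side `2⁻ⁿ` that contain points at `ℓ_p`-distance at most `1`. -/
def CellsClose (p : ENNReal) [Fact (1 ≤ p)] (n : ℕ) (z w : Fin d → ℤ) : Prop :=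
  ∃ x y : Fin d → ℝ, cellIndex n x = z ∧ cellIndex n y = w ∧ IsClose p x y

lemma abs_sub_le_of_cellIndex_eq {n : ℕ} {x y : Fin d → ℝ} (h : cellIndex n x = cellIndex n y)
    (i : Fin d) : |x i - y i| ≤ (1 / 2) ^ n := by
  have h1 : |2 ^ n * x i - 2 ^ n * y i| < 1 := Int.abs_sub_lt_one_of_floor_eq_floor (congrFun h i)
  rw [← mul_sub, abs_mul, abs_of_pos (by positivity)] at h1
  rw [one_div, inv_pow, ← one_div, le_div_iff₀' (by positivity)]
  exact h1.le

/-- The cells shrink in the `ℓ_p` norm, since all norms on `ℝ^d` are equivalent. -/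
lemma exists_norm_toLp_le (p : ENNReal) [Fact (1 ≤ p)] (d : ℕ) : ∃ K : ℝ, 0 ≤ K ∧
    ∀ (n : ℕ) (x y : Fin d → ℝ), cellIndex n x = cellIndex n y →
      ‖WithLp.toLp p (x - y)‖ ≤ K * (1 / 2) ^ n := by
  obtain ⟨K, hK, hb⟩ := (PiLp.continuousLinearEquiv p ℝ (fun _ : Fin d => ℝ)).symm
    |>.toContinuousLinearMap.bound
  refine ⟨K, hK.le, fun n x y h => (hb (x - y)).trans ?_⟩
  gcongr
  exact (pi_norm_le_iff_of_nonneg (by positivity)).2 fun i => by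
    simpa using abs_sub_le_of_cellIndex_eq h i

lemma measurable_cellIndex (n : ℕ) : Measurable (cellIndex n : (Fin d → ℝ) → Fin d → ℤ) :=
  measurable_pi_lambda _ fun i => ((measurable_pi_apply i).const_mul _).floor

lemma image_cellIndex_subset (n : ℕ) {B : Set (Fin d → ℝ)} {a b : Fin d → ℝ}
    (hB : B ⊆ Set.Icc a b) :
    cellIndex n '' B ⊆ (Finset.Icc (cellIndex n a) (cellIndex n b) : Finset (Fin d → ℤ)) := by
  rintro _ ⟨x, hx, rfl⟩
  obtain ⟨h1, h2⟩ := hB hx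
  exact Finset.mem_coe.2 (Finset.mem_Icc.2
    ⟨fun i => Int.floor_mono (mul_le_mul_of_nonneg_left (h1 i) (by positivity)),
      fun i => Int.floor_mono (mul_le_mul_of_nonneg_left (h2 i) (by positivity))⟩)

/-- The bound comes from a grid so fine that two points of the same cell always conflict: a coloured
set then meets each of the finitely many cells in at most `k` points. -/
lemma exists_colorNumber_le (p : ENNReal) [Fact (1 ≤ p)] (k : ℕ) {B : Set (Fin d → ℝ)}
    {a b : Fin d → ℝ} (hB : B ⊆ Set.Icc a b) :
    ∃ C : ℕ, ∀ V ⊆ B, colorNumber (IsClose p) k V ≤ C := by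
  classical
  obtain ⟨K, hK, hKb⟩ := exists_norm_toLp_le p d
  obtain ⟨n, hn⟩ : ∃ n : ℕ, K * (1 / 2) ^ n ≤ 1 := by
    have : Tendsto (fun n : ℕ => K * (1 / 2 : ℝ) ^ n) atTop (nhds (K * 0)) :=
      (tendsto_pow_atTop_nhds_zero_of_lt_one (by norm_num) (by norm_num)).const_mul K
    exact ((this.eventually (ge_mem_nhds (by simp))).exists)
  refine ⟨(Finset.Icc (cellIndex n a) (cellIndex n b) ×ˢ Finset.range k).card,
    fun V hV => colorNumber_le_iff.2 fun T hT ⟨c, hc1, hc2⟩ => ?_⟩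
  refine Nat.cast_le.2 (Finset.card_le_card_of_injOn (fun x => (cellIndex n x, c x)) ?_ ?_)
  · intro x hx
    exact Finset.mem_coe.2 (Finset.mem_product.2
      ⟨image_cellIndex_subset n hB ⟨x, hV (hT hx), rfl⟩, Finset.mem_range.2 (hc1 x hx)⟩)
  · intro x hx y hy e
    by_contra hne
    simp only [Prod.mk.injEq] at e
    exact hc2 x hx y hy hne ((hKb n x y e.1).trans hn) e.2

lemma colorNumber_cell_le (n : ℕ) (V : Set (Fin d → ℝ)) :
    colorNumber (CellsClose p n) k (cellIndex n '' V) ≤ colorNumber (IsClose p) k V :=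
  colorNumber_image_le _ fun x y h => ⟨x, y, rfl, rfl, h⟩

/-- The colouring condition asks for distances `> 1`, which is an open condition, so an optimal
finite coloured set is seen by all sufficiently fine grids. -/
lemma eventually_colorNumber_cell_eq {V : Set (Fin d → ℝ)}
    (hV : colorNumber (IsClose p) k V ≠ ⊤) :
    ∀ᶠ n in atTop,
      colorNumber (CellsClose p n) k (cellIndex n '' V) = colorNumber (IsClose p) k V := by
  classical
  obtain ⟨T, hT, ⟨c, hc1, hc2⟩, hcard⟩ := exists_card_eq_colorNumber hV
  obtain ⟨K, hK, hKb⟩ := exists_norm_toLp_le p d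
  have hlim : Tendsto (fun n : ℕ => K * (1 / 2 : ℝ) ^ n) atTop (nhds 0) := by
    simpa using (tendsto_pow_atTop_nhds_zero_of_lt_one (by norm_num) (by norm_num)
      : Tendsto (fun n : ℕ => (1 / 2 : ℝ) ^ n) atTop (nhds 0)).const_mul K
  have h1 : ∀ᶠ n in atTop, ∀ x ∈ T, ∀ y ∈ T, x ≠ y → cellIndex n x ≠ cellIndex n y := by
    simp only [Filter.eventually_all_finset]
    intro x _ y _
    by_cases hxy : x = y
    · simp [hxy]
    have hpos : 0 < ‖WithLp.toLp p (x - y)‖ := by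
      rw [norm_pos_iff]
      intro h
      exact hxy (sub_eq_zero.1 ((WithLp.toLp_eq_zero p).1 h))
    filter_upwards [hlim.eventually (gt_mem_nhds hpos)] with n hn _ e
    exact absurd (hKb n x y e) (not_le.2 hn)
  have h2 : ∀ᶠ n in atTop, ∀ x ∈ T, ∀ y ∈ T, x ≠ y → c x = c y →
      ¬ CellsClose p n (cellIndex n x) (cellIndex n y) := by
    simp only [Filter.eventually_all_finset]
    intro x hx y hy
    by_cases hxy : x = y ∨ c x ≠ c y
    · exact Eventually.of_forall fun n h h' => by tauto
    push Not at hxy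
    have hgap : 1 < ‖WithLp.toLp p (x - y)‖ :=
      not_le.1 fun h => hc2 x hx y hy hxy.1 h hxy.2
    filter_upwards [hlim.eventually (gt_mem_nhds (half_pos (sub_pos.2 hgap)))] with n hn _ _
    rintro ⟨x', y', ex, ey, hclose⟩
    have e : WithLp.toLp p (x - y) =
        WithLp.toLp p (x - x') + WithLp.toLp p (x' - y') + WithLp.toLp p (y' - y) := by
      rw [← WithLp.toLp_add, ← WithLp.toLp_add]
      congr 1
      rw [sub_add_sub_cancel, sub_add_sub_cancel]
    have := norm_add₃_le (a := WithLp.toLp p (x - x')) (b := WithLp.toLp p (x' - y'))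
      (c := WithLp.toLp p (y' - y))
    rw [← e] at this
    have h3 := hKb n x x' ex.symm
    have h4 := hKb n y' y ey
    have h5 : ‖WithLp.toLp p (x' - y')‖ ≤ 1 := hclose
    linarith
  filter_upwards [h1, h2] with n hn1 hn2
  refine le_antisymm (colorNumber_cell_le n V) ?_
  have hinj : Set.InjOn (cellIndex n) (T : Set (Fin d → ℝ)) := fun x hx y hy e => by
    by_contra h
    exact hn1 x hx y hy h e
  rw [← hcard, ← Finset.card_image_of_injOn hinj]
  have hinv : ∀ x ∈ T, Function.invFunOn (cellIndex n) (T : Set (Fin d → ℝ)) (cellIndex n x) = x :=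
    fun x hx => hinj.leftInvOn_invFunOn hx
  refine card_le_colorNumber (by simpa using Set.image_mono hT)
    ⟨fun z => c (Function.invFunOn (cellIndex n) (T : Set (Fin d → ℝ)) z), ?_, ?_⟩
  · intro z hz
    obtain ⟨x, hx, rfl⟩ := Finset.mem_image.1 (Finset.mem_coe.1 hz)
    simpa only [hinv x hx] using hc1 x hx
  · intro z hz w hw hzw hR
    obtain ⟨x, hx, rfl⟩ := Finset.mem_image.1 (Finset.mem_coe.1 hz)
    obtain ⟨y, hy, rfl⟩ := Finset.mem_image.1 (Finset.mem_coe.1 hw)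
    simp only [hinv x hx, hinv y hy]
    exact fun e => hn2 x hx y hy (fun h => hzw (by rw [h])) e hR

end

/-! ### Coloured points of a Poisson process and their grid approximations -/

section
variable {d : ℕ}

/-- The maximum number of points of `V` in the window `B` that can be coloured with `k` colours, as
a real number. -/
def windowCount (p : ENNReal) [Fact (1 ≤ p)] (k : ℕ) (B V : Set (Fin d → ℝ)) : ℝ :=
  ((colorNumber (IsClose p) k (B ∩ V)).toNat : ℝ)

/-- The maximum number of dyadic cells of side `2⁻ⁿ` that contain a point of `B ∩ V` and can be
coloured with `k` colours, where cells containing points at distance at most `1` conflict. -/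
def gridCount (p : ENNReal) [Fact (1 ≤ p)] (k n : ℕ) (B V : Set (Fin d → ℝ)) : ℝ :=
  ((colorNumber (CellsClose p n) k (cellIndex n '' (B ∩ V))).toNat : ℝ)

/-- `gridCount` as a function of the numbers of points in the cells with labels in `Z`. -/
def gridFun (p : ENNReal) [Fact (1 ≤ p)] (k n : ℕ) (Z : Finset (Fin d → ℤ)) (v : Z → ℕ∞) : ℝ :=
  ((colorNumber (CellsClose p n) k {z | ∃ h : z ∈ Z, v ⟨z, h⟩ ≠ 0}).toNat : ℝ)

/-- The part of the window `B` in the dyadic cell of side `2⁻ⁿ` labelled `z`. -/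
def cellPart (n : ℕ) (B : Set (Fin d → ℝ)) (z : Fin d → ℤ) : Set (Fin d → ℝ) :=
  B ∩ cellIndex n ⁻¹' {z}

/-- The expectation of `gridCount` for a Poisson process of intensity `lam` and a window
`B ⊆ Set.Icc a b`, as an integral against the product of the Poisson laws of the cell counts. -/
def gridMean (p : ENNReal) [Fact (1 ≤ p)] (k n : ℕ) (lam : ℝ) (a b : Fin d → ℝ)
    (B : Set (Fin d → ℝ)) : ℝ :=
  ∫ v, gridFun p k n (Finset.Icc (cellIndex n a) (cellIndex n b)) v
    ∂Measure.pi fun z : Finset.Icc (cellIndex n a) (cellIndex n b) =>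
      (poissonMeasure (lam * volume.real (cellPart n B z)).toNNReal).map (fun m : ℕ => (m : ℕ∞))

/-- The expectation of `windowCount` for a Poisson process of intensity `lam` and a window
`B ⊆ Set.Icc a b`, defined without reference to a realization of the process. -/
def windowMean (p : ENNReal) [Fact (1 ≤ p)] (k : ℕ) (lam : ℝ) (a b : Fin d → ℝ)
    (B : Set (Fin d → ℝ)) : ℝ :=
  limUnder atTop fun n => gridMean p k n lam a b B

variable {p : ENNReal} [Fact (1 ≤ p)] {k : ℕ} {A B V : Set (Fin d → ℝ)} {a b a' b' : Fin d → ℝ}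

lemma coloredCount_eq_windowCount {Ω : Type*} (X : Ω → Set (Fin d → ℝ)) (t : ℝ) (ω : Ω) :
    coloredCount p k X t ω = windowCount p k (Set.Icc (fun _ => 0) (fun _ => t)) (X ω) := by
  rw [coloredCount, windowCount, maxColoredPoints_eq_colorNumber]

lemma windowCount_nonneg : 0 ≤ windowCount p k B V := Nat.cast_nonneg _

lemma gridCount_nonneg {n : ℕ} : 0 ≤ gridCount p k n B V := Nat.cast_nonneg _

lemma colorNumber_inter_ne_top (hB : B ⊆ Set.Icc a b) :
    colorNumber (IsClose p) k (B ∩ V) ≠ ⊤ := by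
  obtain ⟨C, hC⟩ := exists_colorNumber_le p k hB
  exact ne_top_of_le_ne_top (ENat.natCast_ne_top C) (hC _ Set.inter_subset_left)

lemma exists_windowCount_le (p : ENNReal) [Fact (1 ≤ p)] (k : ℕ) (hB : B ⊆ Set.Icc a b) :
    ∃ C : ℝ, 0 ≤ C ∧ ∀ V, windowCount p k B V ≤ C := by
  obtain ⟨C, hC⟩ := exists_colorNumber_le p k hB
  refine ⟨C, Nat.cast_nonneg C, fun V => Nat.cast_le.2 ?_⟩
  exact ENat.toNat_le_of_le_natCast (hC _ Set.inter_subset_left)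

lemma gridCount_le_windowCount (hB : B ⊆ Set.Icc a b) (n : ℕ) :
    gridCount p k n B V ≤ windowCount p k B V :=
  Nat.cast_le.2 (ENat.toNat_le_toNat (colorNumber_cell_le n _) (colorNumber_inter_ne_top hB))

lemma tendsto_gridCount (hB : B ⊆ Set.Icc a b) :
    Tendsto (fun n => gridCount p k n B V) atTop (nhds (windowCount p k B V)) := by
  refine tendsto_const_nhds.congr' ?_
  filter_upwards [eventually_colorNumber_cell_eq (p := p) (k := k)
    (colorNumber_inter_ne_top (V := V) hB)] with n hn
  rw [gridCount, windowCount, hn]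

lemma windowCount_mono (hB : B ⊆ Set.Icc a b) (hAB : A ⊆ B) :
    windowCount p k A V ≤ windowCount p k B V :=
  Nat.cast_le.2 (ENat.toNat_le_toNat (colorNumber_mono (Set.inter_subset_inter_left V hAB))
    (colorNumber_inter_ne_top hB))

lemma windowCount_le_sum {ι : Type*} (s : Finset ι) (D : ι → Set (Fin d → ℝ))
    (hD : ∀ i ∈ s, ∃ a b, D i ⊆ Set.Icc a b) (h : B ⊆ ⋃ i ∈ s, D i) :
    windowCount p k B V ≤ ∑ i ∈ s, windowCount p k (D i) V := by
  have hne : ∀ i ∈ s, colorNumber (IsClose p) k (D i ∩ V) ≠ ⊤ := fun i hi => by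
    obtain ⟨a, b, hab⟩ := hD i hi
    exact colorNumber_inter_ne_top hab
  have h1 : colorNumber (IsClose p) k (B ∩ V) ≤
      ∑ i ∈ s, colorNumber (IsClose p) k (D i ∩ V) := by
    refine colorNumber_le_sum s _ fun x hx => ?_
    simpa [hx.2] using h hx.1
  have h2 : ∑ i ∈ s, colorNumber (IsClose p) k (D i ∩ V) =
      ((∑ i ∈ s, (colorNumber (IsClose p) k (D i ∩ V)).toNat : ℕ) : ℕ∞) := by
    push_cast
    exact Finset.sum_congr rfl fun i hi => (ENat.natCast_toNat (hne i hi)).symm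
  rw [h2] at h1
  simp only [windowCount]
  exact_mod_cast ENat.toNat_le_of_le_natCast h1

lemma windowCount_translate (x : Fin d → ℝ) :
    windowCount p k ((fun y => y - x) ⁻¹' B) V = windowCount p k B ((fun y => y + x) ⁻¹' V) := by
  have key : ∀ (O : Set (Fin d → ℝ)) (v : Fin d → ℝ),
      colorNumber (IsClose p) k ((fun y => y + v) '' O) ≤ colorNumber (IsClose p) k O :=
    fun O v => colorNumber_image_le _ fun x y h => by
      simpa only [IsClose, add_sub_add_right_eq_sub] using h
  unfold windowCount
  congr 2
  have h1 : (fun y => y - x) ⁻¹' B ∩ V = (fun y => y + x) '' (B ∩ (fun y => y + x) ⁻¹' V) := by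
    refine Set.ext fun y => ⟨fun ⟨h1, h2⟩ => ⟨y - x, ⟨h1, ?_⟩, sub_add_cancel y x⟩, ?_⟩
    · simpa using h2
    · rintro ⟨w, ⟨h1, h2⟩, rfl⟩
      exact ⟨by simpa using h1, h2⟩
  have h2 : B ∩ (fun y => y + x) ⁻¹' V = (fun y => y + -x) '' ((fun y => y - x) ⁻¹' B ∩ V) := by
    rw [h1, Set.image_image]
    simp
  exact le_antisymm (h1 ▸ key _ x) (h2 ▸ key _ (-x))

/-- Only the emptiness of each cell matters, so the grid count is determined by finitely many cell
counts. -/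
lemma gridCount_eq_gridFun (n : ℕ) {Z : Finset (Fin d → ℤ)} (hZ : cellIndex n '' B ⊆ Z) :
    gridCount p k n B V = gridFun p k n Z fun z => (V ∩ cellPart n B z).encard := by
  unfold gridCount gridFun
  congr 3
  ext z
  simp only [Set.mem_image, Set.mem_ofPred_eq, ne_eq, Set.encard_eq_zero, exists_prop,
    ← Set.nonempty_iff_ne_empty]
  constructor
  · rintro ⟨x, ⟨hxB, hxV⟩, rfl⟩
    exact ⟨hZ ⟨x, hxB, rfl⟩, x, hxV, hxB, rfl⟩
  · rintro ⟨-, x, hxV, hxB, hx⟩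
    exact ⟨x, ⟨hxB, hxV⟩, hx⟩

lemma measurableSet_cellPart (hB : MeasurableSet B) (n : ℕ) (z : Fin d → ℤ) :
    MeasurableSet (cellPart n B z) :=
  hB.inter (measurable_cellIndex n (measurableSet_singleton z))

lemma disjoint_cellPart {n : ℕ} {z w : Fin d → ℤ} (h : z ≠ w) :
    Disjoint (cellPart n A z) (cellPart n B w) :=
  Set.disjoint_left.2 fun _ hx hy => h (hx.2.symm.trans hy.2)

lemma volume_ne_top_of_subset_Icc (hB : B ⊆ Set.Icc a b) : volume B ≠ ⊤ :=
  ne_top_of_le_ne_top isCompact_Icc.measure_lt_top.ne (measure_mono hB)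

end

namespace IsPoissonPointProcess

variable {d : ℕ} {Ω : Type*} [MeasurableSpace Ω] {P : Measure Ω} {lam : ℝ}
  {X : Ω → Set (Fin d → ℝ)} {p : ENNReal} [Fact (1 ≤ p)] {k : ℕ} {A B : Set (Fin d → ℝ)}
  {a b a' b' : Fin d → ℝ}

lemma iIndepFun_fintype (hX : IsPoissonPointProcess lam X P) {ι : Type*} [Fintype ι]
    (B : ι → Set (Fin d → ℝ)) (hB : ∀ i, MeasurableSet (B i))
    (hd : ∀ i j, i ≠ j → Disjoint (B i) (B j)) :
    iIndepFun (fun (i : ι) (ω : Ω) => (X ω ∩ B i).encard) P := by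
  let e := Fintype.equivFin ι
  have := (hX.iIndepFun_count _ (B ∘ e.symm) (fun i => hB _)
    (fun i j h => hd _ _ (e.symm.injective.ne h))).precomp e.injective
  simpa using this

/-- The process seen from the point `x` is again a Poisson process. -/
lemma translate (hX : IsPoissonPointProcess lam X P) (x : Fin d → ℝ) :
    IsPoissonPointProcess lam (fun ω => (fun y => y + x) ⁻¹' X ω) P := by
  have hc : ∀ (B : Set (Fin d → ℝ)) (ω : Ω), ((fun y => y + x) ⁻¹' X ω ∩ B).encard =
      (X ω ∩ (fun y => y - x) ⁻¹' B).encard := fun B ω => by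
    have : (fun y => y + x) ⁻¹' X ω ∩ B =
        (Equiv.addRight x) ⁻¹' (X ω ∩ (fun y => y - x) ⁻¹' B) := by
      ext y
      simp
    rw [this, Set.encard_preimage_of_bijective (Equiv.addRight x).bijective]
  have hm : ∀ B : Set (Fin d → ℝ), MeasurableSet B → MeasurableSet ((fun y => y - x) ⁻¹' B) :=
    fun B hB => (measurable_id.sub_const x) hB
  have hv : ∀ B : Set (Fin d → ℝ), volume ((fun y => y - x) ⁻¹' B) = volume B := fun B => by
    simp only [sub_eq_add_neg, measure_preimage_add_right]
  refine ⟨fun B hB => ?_, fun B hB hBv => ?_, fun n B hB hd => ?_⟩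
  · simpa only [hc] using hX.measurable_count _ (hm B hB)
  · simp only [hc]
    rw [hX.map_count _ (hm B hB) (by rwa [hv]), measureReal_def, hv, measureReal_def]
  · simp only [hc]
    exact hX.iIndepFun_count n _ (fun i => hm _ (hB i)) fun i j h => (hd i j h).preimage _

lemma measurable_gridCount (hX : IsPoissonPointProcess lam X P) (hBm : MeasurableSet B)
    (hB : B ⊆ Set.Icc a b) (n : ℕ) : Measurable fun ω => gridCount p k n B (X ω) := by
  have hZ := image_cellIndex_subset n hB
  simp only [gridCount_eq_gridFun n hZ]
  exact (Measurable.of_discrete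
    (f := gridFun p k n (Finset.Icc (cellIndex n a) (cellIndex n b)))).comp
    (measurable_pi_lambda _ fun z => hX.measurable_count _ (measurableSet_cellPart hBm n z))

lemma measurable_windowCount (hX : IsPoissonPointProcess lam X P) (hBm : MeasurableSet B)
    (hB : B ⊆ Set.Icc a b) : Measurable fun ω => windowCount p k B (X ω) :=
  measurable_of_tendsto_metrizable (fun n => hX.measurable_gridCount hBm hB n)
    (tendsto_pi_nhds.2 fun _ => tendsto_gridCount hB)

lemma memLp_windowCount [IsProbabilityMeasure P] (hX : IsPoissonPointProcess lam X P)
    (hBm : MeasurableSet B) (hB : B ⊆ Set.Icc a b) (q : ENNReal) :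
    MemLp (fun ω => windowCount p k B (X ω)) q P := by
  obtain ⟨C, -, hC⟩ := exists_windowCount_le p k hB
  refine MemLp.of_bound (hX.measurable_windowCount hBm hB).aestronglyMeasurable C ?_
  exact .of_forall fun ω => by
    rw [Real.norm_of_nonneg windowCount_nonneg]
    exact hC _

lemma integrable_windowCount [IsProbabilityMeasure P] (hX : IsPoissonPointProcess lam X P)
    (hBm : MeasurableSet B) (hB : B ⊆ Set.Icc a b) :
    Integrable (fun ω => windowCount p k B (X ω)) P :=
  memLp_one_iff_integrable.1 (hX.memLp_windowCount hBm hB 1)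

lemma tendsto_integral_gridCount [IsProbabilityMeasure P] (hX : IsPoissonPointProcess lam X P)
    (hBm : MeasurableSet B) (hB : B ⊆ Set.Icc a b) :
    Tendsto (fun n => ∫ ω, gridCount p k n B (X ω) ∂P) atTop
      (nhds (∫ ω, windowCount p k B (X ω) ∂P)) := by
  refine tendsto_integral_of_dominated_convergence (fun ω => windowCount p k B (X ω))
    (fun n => (hX.measurable_gridCount hBm hB n).aestronglyMeasurable)
    (hX.integrable_windowCount hBm hB) (fun n => .of_forall fun ω => ?_)
    (.of_forall fun ω => tendsto_gridCount hB)
  rw [Real.norm_of_nonneg gridCount_nonneg]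
  exact gridCount_le_windowCount hB n

lemma integral_gridCount [IsProbabilityMeasure P] (hX : IsPoissonPointProcess lam X P)
    (hBm : MeasurableSet B) (hB : B ⊆ Set.Icc a b) (n : ℕ) :
    ∫ ω, gridCount p k n B (X ω) ∂P = gridMean p k n lam a b B := by
  have hZ := image_cellIndex_subset n hB
  unfold gridMean
  set Z := Finset.Icc (cellIndex n a) (cellIndex n b)
  have hm : ∀ z : Z, Measurable fun ω => (X ω ∩ cellPart n B z).encard :=
    fun z => hX.measurable_count _ (measurableSet_cellPart hBm n z)
  have hind := hX.iIndepFun_fintype (fun z : Z => cellPart n B z)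
    (fun z => measurableSet_cellPart hBm n z)
    (fun z w h => disjoint_cellPart fun e => h (Subtype.ext e))
  rw [iIndepFun_iff_map_fun_eq_pi_map fun z => (hm z).aemeasurable] at hind
  have hlaw : ∀ z : Z, P.map (fun ω => (X ω ∩ cellPart n B z).encard) =
      (poissonMeasure (lam * volume.real (cellPart n B z)).toNNReal).map
        (fun m : ℕ => (m : ℕ∞)) := fun z =>
    hX.map_count _ (measurableSet_cellPart hBm n z)
      (volume_ne_top_of_subset_Icc (Set.inter_subset_left.trans hB))
  simp only [hlaw] at hind
  rw [← hind, integral_map (measurable_pi_lambda _ hm).aemeasurable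
    Measurable.of_discrete.aestronglyMeasurable]
  simp only [gridCount_eq_gridFun n hZ]

/-- The expected number of coloured points in a window depends only on the intensity, not on the
realization of the process. -/
lemma integral_windowCount [IsProbabilityMeasure P] (hX : IsPoissonPointProcess lam X P)
    (hBm : MeasurableSet B) (hB : B ⊆ Set.Icc a b) :
    ∫ ω, windowCount p k B (X ω) ∂P = windowMean p k lam a b B := by
  have h := hX.tendsto_integral_gridCount (p := p) (k := k) hBm hB
  simp only [hX.integral_gridCount hBm hB] at h
  exact h.limUnder_eq.symm

lemma indepFun_gridCount (hX : IsPoissonPointProcess lam X P)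
    (hAm : MeasurableSet A) (hA : A ⊆ Set.Icc a b) (hBm : MeasurableSet B)
    (hB : B ⊆ Set.Icc a' b') (hAB : Disjoint A B) (n : ℕ) :
    IndepFun (fun ω => gridCount p k n A (X ω)) (fun ω => gridCount p k n B (X ω)) P := by
  classical
  have hZA := image_cellIndex_subset n hA
  have hZB := image_cellIndex_subset n hB
  set ZA := Finset.Icc (cellIndex n a) (cellIndex n b)
  set ZB := Finset.Icc (cellIndex n a') (cellIndex n b')
  let D : ZA ⊕ ZB → Set (Fin d → ℝ) := Sum.elim (fun z => cellPart n A z) (fun z => cellPart n B z)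
  have hDm : ∀ i, MeasurableSet (D i) := by
    rintro (z | z)
    · exact measurableSet_cellPart hAm n z
    · exact measurableSet_cellPart hBm n z
  have hDd : ∀ i j, i ≠ j → Disjoint (D i) (D j) := by
    rintro (z | z) (w | w) h
    · exact disjoint_cellPart fun e => h (by rw [Subtype.ext e])
    · exact hAB.mono Set.inter_subset_left Set.inter_subset_left
    · exact hAB.symm.mono Set.inter_subset_left Set.inter_subset_left
    · exact disjoint_cellPart fun e => h (by rw [Subtype.ext e])
  have hind := (hX.iIndepFun_fintype D hDm hDd).indepFun_finset
    (Finset.univ.map Function.Embedding.inl) (Finset.univ.map Function.Embedding.inr)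
    (by simp [Finset.disjoint_left]) (fun i => hX.measurable_count _ (hDm i))
  have := hind.comp
    (φ := fun v => gridFun p k n ZA fun z => v ⟨Sum.inl z, by simp⟩)
    (ψ := fun v => gridFun p k n ZB fun z => v ⟨Sum.inr z, by simp⟩)
    Measurable.of_discrete Measurable.of_discrete
  simp only [gridCount_eq_gridFun n hZA, gridCount_eq_gridFun n hZB]
  exact this

/-- Independence of the grid counts passes to the limit in the form of a vanishing covariance, which
is all that the second moment method needs. -/
lemma covariance_windowCount [IsProbabilityMeasure P] (hX : IsPoissonPointProcess lam X P)
    (hAm : MeasurableSet A) (hA : A ⊆ Set.Icc a b) (hBm : MeasurableSet B)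
    (hB : B ⊆ Set.Icc a' b') (hAB : Disjoint A B) :
    cov[fun ω => windowCount p k A (X ω), fun ω => windowCount p k B (X ω); P] = 0 := by
  obtain ⟨C, hC0, hC⟩ := exists_windowCount_le p k hA
  rw [covariance_eq_sub (hX.memLp_windowCount hAm hA 2) (hX.memLp_windowCount hBm hB 2),
    sub_eq_zero]
  have h1 : Tendsto (fun n => ∫ ω, gridCount p k n A (X ω) * gridCount p k n B (X ω) ∂P) atTop
      (nhds (∫ ω, windowCount p k A (X ω) * windowCount p k B (X ω) ∂P)) := by
    refine tendsto_integral_of_dominated_convergence (fun ω => C * windowCount p k B (X ω))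
      (fun n => ((hX.measurable_gridCount hAm hA n).mul
        (hX.measurable_gridCount hBm hB n)).aestronglyMeasurable)
      ((hX.integrable_windowCount hBm hB).const_mul C) (fun n => .of_forall fun ω => ?_)
      (.of_forall fun ω => (tendsto_gridCount hA).mul (tendsto_gridCount hB))
    rw [Real.norm_of_nonneg (mul_nonneg gridCount_nonneg gridCount_nonneg)]
    exact mul_le_mul ((gridCount_le_windowCount hA n).trans (hC _)) (gridCount_le_windowCount hB n)
      gridCount_nonneg hC0
  have h2 := (hX.tendsto_integral_gridCount (p := p) (k := k) hAm hA).mul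
    (hX.tendsto_integral_gridCount (p := p) (k := k) hBm hB)
  refine tendsto_nhds_unique h1 (h2.congr fun n => ?_)
  exact ((hX.indepFun_gridCount hAm hA hBm hB hAB n).integral_fun_mul_eq_mul_integral
    (hX.measurable_gridCount hAm hA n).aestronglyMeasurable
    (hX.measurable_gridCount hBm hB n).aestronglyMeasurable).symm

end IsPoissonPointProcess

/-! ### Covering a large cube by disjoint small cubes -/

section
variable {d : ℕ}

/-- The half-open cube `s z + [0, s)^d`, as a translate of `[0, s)^d`. -/
def latticeCube (s : ℝ) (z : Fin d → ℕ) : Set (Fin d → ℝ) :=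
  (fun y => y - fun i => s * z i) ⁻¹' Set.univ.pi fun _ => Set.Ico 0 s

lemma mem_latticeCube {s : ℝ} {z : Fin d → ℕ} {y : Fin d → ℝ} :
    y ∈ latticeCube s z ↔ ∀ i, s * z i ≤ y i ∧ y i < s * (z i + 1) := by
  simp only [latticeCube, Set.mem_preimage, Set.mem_univ_pi, Set.mem_Ico, Pi.sub_apply, sub_nonneg,
    sub_lt_iff_lt_add, mul_add, mul_one, add_comm s]

lemma measurableSet_latticeCube (s : ℝ) (z : Fin d → ℕ) : MeasurableSet (latticeCube s z) :=
  (measurable_id.sub_const _) (MeasurableSet.univ_pi fun _ => measurableSet_Ico)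

lemma latticeCube_subset_Icc (s : ℝ) (z : Fin d → ℕ) :
    latticeCube s z ⊆ Set.Icc (fun i => s * z i) (fun i => s * (z i + 1)) := fun _ hy =>
  ⟨fun i => (mem_latticeCube.1 hy i).1, fun i => (mem_latticeCube.1 hy i).2.le⟩

lemma disjoint_latticeCube {s : ℝ} (hs : 0 < s) {z w : Fin d → ℕ} (h : z ≠ w) :
    Disjoint (latticeCube s z) (latticeCube s w) := by
  refine Set.disjoint_left.2 fun y hy hy' => h (funext fun i => ?_)
  obtain ⟨h1, h2⟩ := mem_latticeCube.1 hy i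
  obtain ⟨h3, h4⟩ := mem_latticeCube.1 hy' i
  have h5 := lt_of_mul_lt_mul_left (h1.trans_lt h4) hs.le
  have h6 := lt_of_mul_lt_mul_left (h3.trans_lt h2) hs.le
  norm_cast at h5 h6
  omega

lemma Icc_subset_iUnion_latticeCube {s : ℝ} (hs : 0 < s) (t : ℝ) :
    Set.Icc (fun _ => 0) (fun _ => t) ⊆
      ⋃ z ∈ Fintype.piFinset fun _ : Fin d => Finset.range (⌊s⁻¹ * t⌋₊ + 1), latticeCube s z := by
  intro y ⟨hy0, hyt⟩
  have h0 : ∀ i, 0 ≤ s⁻¹ * y i := fun i => mul_nonneg (inv_pos.2 hs).le (hy0 i)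
  simp only [Set.mem_iUnion, exists_prop]
  refine ⟨fun i => ⌊s⁻¹ * y i⌋₊, ?_, mem_latticeCube.2 fun i => ⟨?_, ?_⟩⟩
  · refine Fintype.mem_piFinset.2 fun i => Finset.mem_range.2
      (Nat.lt_succ_of_le (Nat.floor_mono ?_))
    exact mul_le_mul_of_nonneg_left (hyt i) (inv_pos.2 hs).le
  · rw [← le_inv_mul_iff₀ hs]
    exact Nat.floor_le (h0 i)
  · rw [← inv_mul_lt_iff₀ hs]
    exact Nat.lt_floor_add_one _

end

namespace IsPoissonPointProcess

variable {d : ℕ} {Ω : Type*} [MeasurableSpace Ω] {P : Measure Ω} [IsProbabilityMeasure P] {lam : ℝ}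
  {X : Ω → Set (Fin d → ℝ)} {p : ENNReal} [Fact (1 ≤ p)] {k : ℕ}

/-- By translation invariance of the process, every lattice cube of side `s` has at most as many
coloured points in the mean as `[0, s]^d`. -/
lemma integral_windowCount_latticeCube_le (hX : IsPoissonPointProcess lam X P) (s : ℝ)
    (z : Fin d → ℕ) :
    ∫ ω, windowCount p k (latticeCube s z) (X ω) ∂P ≤
      ∫ ω, windowCount p k (Set.Icc (fun _ => 0) (fun _ => s)) (X ω) ∂P := by
  have hsub : (Set.univ.pi fun _ : Fin d => Set.Ico (0 : ℝ) s) ⊆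
      Set.Icc (fun _ => 0) (fun _ => s) := fun y hy =>
    ⟨fun i => (hy i trivial).1, fun i => (hy i trivial).2.le⟩
  have hm : MeasurableSet (Set.univ.pi fun _ : Fin d => Set.Ico (0 : ℝ) s) :=
    MeasurableSet.univ_pi fun _ => measurableSet_Ico
  simp only [latticeCube, windowCount_translate]
  rw [(hX.translate _).integral_windowCount hm hsub, ← hX.integral_windowCount hm hsub]
  exact integral_mono (hX.integrable_windowCount hm hsub)
    (hX.integrable_windowCount measurableSet_Icc subset_rfl)
    fun ω => windowCount_mono subset_rfl hsub

/-- The counts in distinct lattice cubes are uncorrelated and, by translation, uniformly bounded. -/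
lemma exists_variance_sum_latticeCube_le (hX : IsPoissonPointProcess lam X P) {s : ℝ} (hs : 0 < s) :
    ∃ C : ℝ, ∀ I : Finset (Fin d → ℕ),
      Var[fun ω => ∑ z ∈ I, windowCount p k (latticeCube s z) (X ω); P] ≤ I.card * C := by
  obtain ⟨C, hC0, hC⟩ := exists_windowCount_le p k (B := Set.univ.pi fun _ : Fin d => Set.Ico 0 s)
    (a := fun _ => 0) (b := fun _ => s)
    fun y hy => ⟨fun i => (hy i trivial).1, fun i => (hy i trivial).2.le⟩
  have hL : ∀ z, MemLp (fun ω => windowCount p k (latticeCube s z) (X ω)) 2 P := fun z =>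
    hX.memLp_windowCount (measurableSet_latticeCube s z) (latticeCube_subset_Icc s z) 2
  refine ⟨C ^ 2, fun I => ?_⟩
  rw [variance_fun_sum' fun z _ => hL z, ← nsmul_eq_mul]
  refine Finset.sum_le_card_nsmul _ _ _ fun z hz => ?_
  rw [Finset.sum_eq_single_of_mem z hz fun w _ hw => hX.covariance_windowCount
    (measurableSet_latticeCube s z) (latticeCube_subset_Icc s z) (measurableSet_latticeCube s w)
    (latticeCube_subset_Icc s w) (disjoint_latticeCube hs hw.symm),
    covariance_self (hL z).aestronglyMeasurable.aemeasurable]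
  refine (variance_le_expectation_sq (hL z).aestronglyMeasurable).trans ?_
  have : ∫ ω, ((fun ω => windowCount p k (latticeCube s z) (X ω)) ^ 2) ω ∂P ≤ ∫ _, C ^ 2 ∂P :=
    integral_mono (hL z).integrable_sq (integrable_const _) fun ω =>
      pow_le_pow_left₀ windowCount_nonneg ((windowCount_translate _).trans_le (hC _)) 2
  simpa using this

end IsPoissonPointProcess

/-! ### Convergence in mean -/

/-- A random variable whose mean is at least `a` and which is dominated by a variable with mean not
much above `a` and small variance is close to `a` in mean: its positive deviations are small, and
the negative ones are balanced by them. -/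
lemma integral_abs_sub_le {Ω : Type*} [MeasurableSpace Ω] {P : Measure Ω} [IsProbabilityMeasure P]
    {Y S : Ω → ℝ} (hY : Integrable Y P) (hS : MemLp S 2 P) (hYS : ∀ ω, Y ω ≤ S ω) {a m ε : ℝ}
    (ha : a ≤ ∫ ω, Y ω ∂P) (hm0 : 0 ≤ m) (hm : ∫ ω, S ω ∂P ≤ a + m) (hε : 0 < ε) :
    ∫ ω, |Y ω - a| ∂P ≤ 2 * (ε + Var[S; P] / ε + m) := by
  set μ := ∫ ω, S ω ∂P with hμ
  have hpt : ∀ ω, |Y ω - a| ≤ 2 * (ε + (S ω - μ) ^ 2 / ε + m) - (Y ω - a) := by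
    intro ω
    have h1 : S ω - μ ≤ ε + (S ω - μ) ^ 2 / ε := by
      have : ε + (S ω - μ) ^ 2 / ε - (S ω - μ) =
          ((ε - (S ω - μ) / 2) ^ 2 + 3 / 4 * (S ω - μ) ^ 2) / ε := by
        field_simp
        ring
      have : 0 ≤ ε + (S ω - μ) ^ 2 / ε - (S ω - μ) := by rw [this]; positivity
      linarith
    have h2 : 0 ≤ ε + (S ω - μ) ^ 2 / ε := by positivity
    have h3 := hYS ω
    rw [abs_le]
    constructor <;> linarith
  have hsq : Integrable (fun ω => (S ω - μ) ^ 2) P := (hS.sub (memLp_const μ)).integrable_sq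
  have hi0 : Integrable (fun ω => ε + (S ω - μ) ^ 2 / ε) P :=
    (integrable_const ε).add (hsq.div_const ε)
  have hi1 : Integrable (fun ω => ε + (S ω - μ) ^ 2 / ε + m) P := hi0.add (integrable_const m)
  have hYa : Integrable (fun ω => Y ω - a) P := hY.sub (integrable_const a)
  refine (integral_mono hYa.abs ((hi1.const_mul 2).sub hYa) hpt).trans ?_
  have e1 : ∫ ω, (2 * (ε + (S ω - μ) ^ 2 / ε + m) - (Y ω - a)) ∂P =
      2 * (ε + Var[S; P] / ε + m) - (∫ ω, Y ω ∂P - a) := by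
    rw [integral_sub (hi1.const_mul 2) hYa, integral_const_mul,
      integral_sub hY (integrable_const a),
      integral_add hi0 (integrable_const m),
      integral_add (integrable_const ε) (hsq.div_const ε), integral_div,
      variance_eq_integral hS.aestronglyMeasurable.aemeasurable]
    simp [hμ]
  refine (le_of_eq e1).trans ?_
  linarith

namespace IsPoissonPointProcess

variable {d : ℕ} {Ω : Type*} [MeasurableSpace Ω] {P : Measure Ω} [IsProbabilityMeasure P] {lam : ℝ}
  {X : Ω → Set (Fin d → ℝ)} {p : ENNReal} [Fact (1 ≤ p)] {k : ℕ}

lemma integrable_coloringRatio (hX : IsPoissonPointProcess lam X P) (t : ℝ) :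
    Integrable (coloringRatio p k lam X t) P := by
  unfold coloringRatio
  simp only [coloredCount_eq_windowCount]
  exact (hX.integrable_windowCount measurableSet_Icc subset_rfl).div_const _

lemma integral_coloringRatio (hX : IsPoissonPointProcess lam X P) (t : ℝ) :
    ∫ ω, coloringRatio p k lam X t ω ∂P =
      windowMean p k lam (fun _ => 0) (fun _ => t) (Set.Icc (fun _ : Fin d => 0) (fun _ => t)) /
        (lam * t ^ d) := by
  unfold coloringRatio
  simp only [coloredCount_eq_windowCount]
  rw [integral_div, hX.integral_windowCount measurableSet_Icc subset_rfl]

/-- The cube of side `t` is covered by `⌊t / s⌋ + 1` lattice cubes of side `s` in each direction;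
the sum of their counts dominates the count of the large cube, has mean close to the infimum after
normalization, and its normalized variance is of order `t⁻ᵈ`. -/
lemma tendsto_integral_abs_coloringRatio_sub (hX : IsPoissonPointProcess lam X P) (hd : 1 ≤ d)
    (hlam : 0 < lam) {a : ℝ}
    (ha : IsGLB ((fun t : ℝ => ∫ ω, coloringRatio p k lam X t ω ∂P) '' Set.Ioi 0) a) :
    Tendsto (fun t => ∫ ω, |coloringRatio p k lam X t ω - a| ∂P) atTop (nhds 0) := by
  rw [Metric.tendsto_nhds]
  intro η hη
  obtain ⟨ε, hε, hεη⟩ : ∃ ε : ℝ, 0 < ε ∧ 2 * (ε + ε + ε) < η := ⟨η / 7, by positivity, by linarith⟩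
  -- A side length `s` whose mean ratio is almost the infimum.
  obtain ⟨_, ⟨s, hs, rfl⟩, has, hsε⟩ := ha.exists_between (lt_add_of_pos_right a hε)
  replace hs : 0 < s := hs
  obtain ⟨C, hC⟩ := hX.exists_variance_sum_latticeCube_le (p := p) (k := k) hs
  set e := ∫ ω, windowCount p k (Set.Icc (fun _ => 0) (fun _ => s)) (X ω) ∂P
  have hes : e / (lam * s ^ d) < a + ε := by
    simpa only [coloringRatio, coloredCount_eq_windowCount, integral_div] using hsε
  let M : ℝ → ℕ := fun t => ⌊s⁻¹ * t⌋₊ + 1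
  have hM : Tendsto (fun t => (M t : ℝ) / t) atTop (nhds s⁻¹) := by
    have h := (tendsto_nat_floor_mul_div_atTop (inv_pos.2 hs).le).add
      (tendsto_inv_atTop_zero (𝕜 := ℝ))
    rw [add_zero] at h
    refine h.congr fun t => ?_
    simp only [M]
    push_cast
    rw [add_div, one_div]
  have hMd := hM.pow d
  have hmean : ∀ᶠ t in atTop, ((M t : ℝ) / t) ^ d * (e / lam) < a + ε := by
    refine (hMd.mul_const (e / lam)).eventually (gt_mem_nhds ?_)
    refine lt_of_eq_of_lt ?_ hes
    rw [inv_pow]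
    field_simp
  have hvar : ∀ᶠ t in atTop, ((M t : ℝ) / t) ^ d * (C / lam ^ 2) * (t ^ d)⁻¹ < ε * ε := by
    have h := (hMd.mul_const (C / lam ^ 2)).mul
      (tendsto_inv_atTop_zero.comp (tendsto_pow_atTop (α := ℝ) (n := d) (by omega)))
    rw [mul_zero] at h
    exact h.eventually (gt_mem_nhds (by positivity))
  filter_upwards [hmean, hvar, eventually_gt_atTop 0] with t hmt hvt ht
  rw [Real.dist_eq, sub_zero, abs_of_nonneg (integral_nonneg fun ω => abs_nonneg _)]
  refine lt_of_le_of_lt ?_ hεη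
  let I := Fintype.piFinset fun _ : Fin d => Finset.range (M t)
  have hI : (I.card : ℝ) = (M t : ℝ) ^ d := by simp [I, Fintype.card_piFinset]
  have hct : 0 < lam * t ^ d := by positivity
  let S : Ω → ℝ := fun ω => ∑ z ∈ I, windowCount p k (latticeCube s z) (X ω)
  have hSL : MemLp S 2 P := memLp_finsetSum _ fun z _ =>
    hX.memLp_windowCount (measurableSet_latticeCube s z) (latticeCube_subset_Icc s z) 2
  have hES : ∫ ω, S ω ∂P ≤ (M t : ℝ) ^ d * e := by
    rw [integral_finsetSum _ fun z _ =>
      hX.integrable_windowCount (measurableSet_latticeCube s z) (latticeCube_subset_Icc s z),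
      ← hI, ← nsmul_eq_mul]
    exact Finset.sum_le_card_nsmul _ _ _ fun z _ => hX.integral_windowCount_latticeCube_le s z
  have key := integral_abs_sub_le (S := fun ω => (lam * t ^ d)⁻¹ * S ω)
    (hX.integrable_coloringRatio (p := p) (k := k) t) (hSL.const_mul _) (fun ω => ?_)
    (ha.1 ⟨t, ht, rfl⟩) hε.le ?_ hε
  · refine key.trans ?_
    rw [variance_const_mul]
    gcongr
    rw [div_le_iff₀ hε]
    refine le_trans ?_ hvt.le
    calc (lam * t ^ d)⁻¹ ^ 2 * Var[S; P] ≤ (lam * t ^ d)⁻¹ ^ 2 * ((M t : ℝ) ^ d * C) := by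
          gcongr
          exact hI ▸ hC I
      _ = _ := by
          rw [div_pow]
          field_simp
  · rw [coloringRatio, coloredCount_eq_windowCount, div_eq_inv_mul]
    refine mul_le_mul_of_nonneg_left ?_ (inv_pos.2 hct).le
    exact windowCount_le_sum I _ (fun z _ => ⟨_, _, latticeCube_subset_Icc s z⟩)
      (Icc_subset_iUnion_latticeCube hs t)
  · rw [integral_const_mul]
    refine le_trans ?_ hmt.le
    calc (lam * t ^ d)⁻¹ * ∫ ω, S ω ∂P ≤ (lam * t ^ d)⁻¹ * ((M t : ℝ) ^ d * e) := by gcongr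
      _ = _ := by
          rw [div_pow]
          field_simp

end IsPoissonPointProcess
end

theorem proposition5 (p : ENNReal) [Fact (1 ≤ p)] (d k : ℕ) (hd : 1 ≤ d) (hk : 1 ≤ k)
    (lam : ℝ) (hlam : 0 < lam) :
    -- the constant depends on `p, d, k, lam` only, not on the realization of the process
    ∃ a : ℝ, ∀ (Ω : Type*) [MeasurableSpace Ω] (P : Measure Ω) [IsProbabilityMeasure P]
      (X : Ω → Set (Fin d → ℝ)), IsPoissonPointProcess lam X P →
        (∀ t : ℝ, 0 < t → Integrable (coloringRatio p k lam X t) P) ∧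
        IsGLB ((fun t : ℝ => ∫ ω, coloringRatio p k lam X t ω ∂P) '' Set.Ioi 0) a ∧
        TendstoInMeasure P (fun (t : ℝ) => coloringRatio p k lam X t) atTop (fun _ => a) := by
  refine ⟨sInf ((fun t : ℝ => windowMean p k lam (fun _ => 0) (fun _ => t)
    (Set.Icc (fun _ : Fin d => 0) (fun _ => t)) / (lam * t ^ d)) '' Set.Ioi 0),
    fun Ω _ P _ X hX => ⟨fun t _ => hX.integrable_coloringRatio t, ?_⟩⟩
  simp only [← hX.integral_coloringRatio]
  have hglb := isGLB_csInf
    (s := (fun t : ℝ => ∫ ω, coloringRatio p k lam X t ω ∂P) '' Set.Ioi 0)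
    ((Set.nonempty_Ioi).image _) ⟨0, by
      rintro _ ⟨t, ht, rfl⟩
      have ht : 0 < t := ht
      exact integral_nonneg fun ω => div_nonneg (Nat.cast_nonneg _) (by positivity)⟩
  refine ⟨hglb, tendstoInMeasure_of_tendsto_eLpNorm one_ne_zero
    (fun t => (hX.integrable_coloringRatio t).aestronglyMeasurable) aestronglyMeasurable_const ?_⟩
  have h := ENNReal.tendsto_ofReal (hX.tendsto_integral_abs_coloringRatio_sub hd hlam hglb)
  rw [ENNReal.ofReal_zero] at h
  refine h.congr fun t => ?_
  rw [eLpNorm_one_eq_lintegral_enorm, ← ofReal_integral_norm_eq_lintegral_enorm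
    ((hX.integrable_coloringRatio t).sub (integrable_const _))]
  rfl
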